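/- Let $K$ be a field with an involution $\bar{\ }$, i.e. an additive map with $\overline{ab}=\bar b\,\bar a$ and $\overline{\bar a}=a$. Let $E=(E^0,E^1,r,s)$ be an arbitrary directed graph: $E^0$ (vertices) and $E^1$ (edges) are sets of any cardinality and $r,s:E^1\to E^0$ are any maps. The Leavitt path algebra $L_K(E)$ is the associative, not necessarily unital, $K$-algebra generated by $E^0\cup E^1\cup\{e^*: e\in E^1\}$ subject to the relations - $vw=\delta_{v,w}v$ for all $v,w\in E^0$; - $s(e)e=e\,r(e)=e$ and $r(e)e^*=e^*s(e)=e^*$ for all $e\in E^1$; - $e^*f=\delta_{e,f}\,r(e)$ for all $e,f\in E^1$; - $v=\sum_{e\in s^{-1}(v)}ee^*$ for every $v\in E^0$ for which $s^{-1}(v)$ is finite and nonempty. The involution of $K$ induces an involution $^*$ on $L_K(E)$, namely the additive map with $(xy)^*=y^*x^*$, $(kx)^*=\bar k x^*$ for $k\in K$, $v^*=v$ for $v\in E^0$, and $(e)^*=e^*$, $(e^*)^*=e$ for $e\in E^1$; thus $\bigl(\sum_i k_ip_iq_i^*\bigr)^*=\sum_i\overline{k_i}\,q_ip_i^*$ for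 paths $p_i,q_i$. An involution $^*$ on a ring $R$ is called $n$-proper if $x_1^*x_1+\dots+x_n^*x_n=0$ implies $x_1=\dots=x_n=0$ for all $x_1,\dots,x_n\in R$; it is called proper if it is $1$-proper, and positive definite if it is $n$-proper for every positive integer $n$. **Proposition.** If the involution on $K$ is positive definite, then the induced involution on $L_K(E)$ is proper. -/

import Mathlib

/-- A directed graph `(E⁰, E¹, r, s)`: a set of vertices, a set of edges (both of arbitrary
cardinality; loops and parallel edges are allowed), and the source and range maps. -/
structure DirectedGraph (V : Type*) (W : Type*) where
  /-- the source of an edge -/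
  s : W → V
  /-- the range of an edge -/
  r : W → V

section ProperInvolutions

/-- The involution of a `*`-ring `R` (not necessarily unital) is `n`-proper if
`x₁* x₁ + ⋯ + xₙ* xₙ = 0` implies `x₁ = ⋯ = xₙ = 0`. -/
def IsNProper (n : ℕ) (R : Type*) [NonUnitalRing R] [StarRing R] : Prop :=
  ∀ x : Fin n → R, ∑ i, star (x i) * x i = 0 → ∀ i, x i = 0

/-- The involution of `R` is proper if it is `1`-proper. -/
def IsProperInvolution (R : Type*) [NonUnitalRing R] [StarRing R] : Prop :=
  IsNProper 1 R

/-- The involution of `R` is positive definite if it is `n`-proper for every positive `n`. -/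
def IsPositiveDefiniteInvolution (R : Type*) [NonUnitalRing R] [StarRing R] : Prop :=
  ∀ n : ℕ, 0 < n → IsNProper n R

theorem isProperInvolution_iff (R : Type*) [NonUnitalRing R] [StarRing R] :
    IsProperInvolution R ↔ ∀ a : R, star a * a = 0 → a = 0 := by
  constructor
  · intro h a ha
    exact h (fun _ => a) (by simpa using ha) 0
  · intro h x hx i
    rw [Fin.sum_univ_one] at hx
    rw [Subsingleton.elim i 0]
    exact h _ hx

end ProperInvolutions

namespace Leavitt

/-- The generators of the Leavitt path algebra: the vertices, the edges `e`, and the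
ghost edges `e*`. -/
inductive Gen (V : Type*) (W : Type*) where
  | vertex (v : V) : Gen V W
  | edge (e : W) : Gen V W
  | ghost (e : W) : Gen V W

namespace Gen

/-- The involution on generators: it fixes vertices and exchanges `e` and `e*`. -/
def adj {V W : Type*} : Gen V W → Gen V W
  | vertex v => vertex v
  | edge e => ghost e
  | ghost e => edge e

theorem adj_adj {V W : Type*} (g : Gen V W) : g.adj.adj = g := by
  cases g <;> rfl

end Gen

/-- The free associative (non-unital) `K`-algebra on the generators, realised as the
semigroup algebra of the free semigroup of nonempty words. -/
abbrev Free (K : Type*) [Field K] (V : Type*) (W : Type*) :=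
  MonoidAlgebra K (FreeSemigroup (Gen V W))

section FreeStar

/-- Reversal of words, with every letter replaced by its adjoint. -/
def revWord {V W : Type*} (w : FreeSemigroup (Gen V W)) : FreeSemigroup (Gen V W) :=
  MulOpposite.unop
    (FreeSemigroup.lift (fun g : Gen V W => MulOpposite.op (FreeSemigroup.of g.adj)) w)

theorem revWord_of {V W : Type*} (g : Gen V W) :
    revWord (FreeSemigroup.of g) = FreeSemigroup.of g.adj := by
  simp [revWord]

theorem revWord_mul {V W : Type*} (x y : FreeSemigroup (Gen V W)) :
    revWord (x * y) = revWord y * revWord x := by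
  simp [revWord]

theorem revWord_revWord {V W : Type*} (x : FreeSemigroup (Gen V W)) :
    revWord (revWord x) = x := by
  induction x using FreeSemigroup.recOnMul with
  | ih1 g => rw [revWord_of, revWord_of, Gen.adj_adj]
  | ih2 g y h₁ h₂ => rw [revWord_mul, revWord_mul, h₁, h₂]

variable {K : Type*} [Field K] [StarRing K] {V W : Type*}

/-- The conjugate-linear extension of `revWord` to the free algebra:
`∑ kᵢ wᵢ ↦ ∑ k̄ᵢ wᵢ*`. -/
noncomputable def freeStar : Free K V W →+ Free K V W :=
  (Finsupp.liftAddHom fun w : FreeSemigroup (Gen V W) =>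
    (MonoidAlgebra.singleAddHom (revWord w)).comp (starAddEquiv (R := K)).toAddMonoidHom).comp
    (MonoidAlgebra.coeffAddEquiv (R := K)).toAddMonoidHom

theorem freeStar_single (w : FreeSemigroup (Gen V W)) (k : K) :
    freeStar (MonoidAlgebra.single w k) = MonoidAlgebra.single (revWord w) (star k) := by
  simp [freeStar]

theorem freeStar_freeStar (x : Free K V W) : freeStar (freeStar x) = x := by
  have h : (freeStar (K := K) (V := V) (W := W)).comp freeStar = AddMonoidHom.id _ := by
    apply MonoidAlgebra.addMonoidHom_ext
    intro w k
    simp [freeStar_single, revWord_revWord]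
  exact DFunLike.congr_fun h x

theorem freeStar_mul (x y : Free K V W) : freeStar (x * y) = freeStar y * freeStar x := by
  induction x using MonoidAlgebra.induction_linear with
  | zero => simp
  | add f g hf hg => rw [add_mul, map_add, map_add, mul_add, hf, hg]
  | single w k =>
    induction y using MonoidAlgebra.induction_linear with
    | zero => simp
    | add f g hf hg => rw [mul_add, map_add, map_add, add_mul, hf, hg]
    | single w' k' =>
      simp [freeStar_single, MonoidAlgebra.single_mul_single, revWord_mul, mul_comm]

theorem freeStar_smul (k : K) (x : Free K V W) : freeStar (k • x) = star k • freeStar x := by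
  induction x using MonoidAlgebra.induction_linear with
  | zero => simp
  | add f g hf hg => rw [smul_add, map_add, map_add, smul_add, hf, hg]
  | single w k' => simp [freeStar_single]

end FreeStar

section Relations

variable {K : Type*} [Field K] {V W : Type*}

/-- A generator, as an element of the free algebra. -/
noncomputable def gen (g : Gen V W) : Free K V W :=
  MonoidAlgebra.single (FreeSemigroup.of g) 1

theorem freeStar_gen [StarRing K] (g : Gen V W) :
    freeStar (gen g : Free K V W) = gen g.adj := by
  simp [gen, freeStar_single, revWord_of]

open Gen in
/-- The defining relations (V), (P1), (P2), (CK1), (CK2) of the Leavitt path algebra; (CK2) is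
imposed exactly at the vertices which emit a finite nonzero number of edges. -/
inductive Rel (E : DirectedGraph V W) : Free K V W → Free K V W → Prop
  | vertex_mul_self (v : V) : Rel E (gen (vertex v) * gen (vertex v)) (gen (vertex v))
  | vertex_mul_of_ne (v w : V) (h : v ≠ w) : Rel E (gen (vertex v) * gen (vertex w)) 0
  | source_mul_edge (e : W) : Rel E (gen (vertex (E.s e)) * gen (edge e)) (gen (edge e))
  | edge_mul_range (e : W) : Rel E (gen (edge e) * gen (vertex (E.r e))) (gen (edge e))
  | range_mul_ghost (e : W) : Rel E (gen (vertex (E.r e)) * gen (ghost e)) (gen (ghost e))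
  | ghost_mul_source (e : W) : Rel E (gen (ghost e) * gen (vertex (E.s e))) (gen (ghost e))
  | ghost_mul_edge_self (e : W) : Rel E (gen (ghost e) * gen (edge e)) (gen (vertex (E.r e)))
  | ghost_mul_edge_of_ne (e f : W) (h : e ≠ f) : Rel E (gen (ghost e) * gen (edge f)) 0
  | sum_edge_mul_ghost (v : V) (hfin : {e : W | E.s e = v}.Finite)
      (hne : {e : W | E.s e = v}.Nonempty) :
      Rel E (gen (vertex v)) (∑ e ∈ hfin.toFinset, gen (edge e) * gen (ghost e))

/-- The smallest `K`-algebra congruence on the free algebra containing the relations. -/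
inductive Cong (E : DirectedGraph V W) : Free K V W → Free K V W → Prop
  | of {x y : Free K V W} (h : Rel E x y) : Cong E x y
  | refl (x : Free K V W) : Cong E x x
  | symm {x y : Free K V W} (h : Cong E x y) : Cong E y x
  | trans {x y z : Free K V W} (h : Cong E x y) (h' : Cong E y z) : Cong E x z
  | add {x y x' y' : Free K V W} (h : Cong E x y) (h' : Cong E x' y') :
      Cong E (x + x') (y + y')
  | mul {x y x' y' : Free K V W} (h : Cong E x y) (h' : Cong E x' y') :
      Cong E (x * x') (y * y')
  | smul (k : K) {x y : Free K V W} (h : Cong E x y) : Cong E (k • x) (k • y)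

/-- `Cong`, as a congruence of rings. -/
def ringCon (K : Type*) [Field K] (E : DirectedGraph V W) : RingCon (Free K V W) where
  r := Cong E
  iseqv := ⟨Cong.refl, Cong.symm, Cong.trans⟩
  add' := Cong.add
  mul' := Cong.mul

theorem Rel.freeStar [StarRing K] {E : DirectedGraph V W} {x y : Free K V W} (h : Rel E x y) :
    Rel E (freeStar x) (freeStar y) := by
  cases h <;> simp only [freeStar_mul, freeStar_gen, map_zero, map_sum, Gen.adj]
  case vertex_mul_self v => exact .vertex_mul_self v
  case vertex_mul_of_ne v w h => exact .vertex_mul_of_ne w v h.symm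
  case source_mul_edge e => exact .ghost_mul_source e
  case edge_mul_range e => exact .range_mul_ghost e
  case range_mul_ghost e => exact .edge_mul_range e
  case ghost_mul_source e => exact .source_mul_edge e
  case ghost_mul_edge_self e => exact .ghost_mul_edge_self e
  case ghost_mul_edge_of_ne e f h => exact .ghost_mul_edge_of_ne f e h.symm
  case sum_edge_mul_ghost v hfin hne => exact .sum_edge_mul_ghost v hfin hne

theorem Cong.freeStar [StarRing K] {E : DirectedGraph V W} {x y : Free K V W}
    (h : Cong E x y) : Cong E (freeStar x) (freeStar y) := by
  induction h with
  | of h => exact .of h.freeStar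
  | refl x => exact .refl _
  | symm _ ih => exact .symm ih
  | trans _ _ ih ih' => exact .trans ih ih'
  | add _ _ ih ih' => rw [map_add, map_add]; exact .add ih ih'
  | mul _ _ ih ih' => rw [freeStar_mul, freeStar_mul]; exact .mul ih' ih
  | smul k _ ih => rw [freeStar_smul, freeStar_smul]; exact .smul _ ih

end Relations

end Leavitt

/-- The Leavitt path algebra `L_K(E)`: the associative `K`-algebra, in general without unit,
generated by the vertices, edges and ghost edges of `E` subject to the relations `Leavitt.Rel`. -/
def LeavittPathAlgebra (K : Type*) [Field K] {V W : Type*} (E : DirectedGraph V W) :=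
  (Leavitt.ringCon K E).Quotient

namespace LeavittPathAlgebra

open Leavitt

variable {K : Type*} [Field K] {V W : Type*} {E : DirectedGraph V W}

noncomputable instance : NonUnitalRing (LeavittPathAlgebra K E) :=
  inferInstanceAs (NonUnitalRing (Leavitt.ringCon K E).Quotient)

/-- The canonical projection from the free algebra. -/
noncomputable def mk (E : DirectedGraph V W) : Free K V W →ₙ+* LeavittPathAlgebra K E where
  toFun x := (x : (Leavitt.ringCon K E).Quotient)
  map_mul' _ _ := rfl
  map_zero' := rfl
  map_add' _ _ := rfl

theorem mk_surjective : Function.Surjective (mk (K := K) E) := Quotient.mk_surjective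

theorem mk_eq_iff {x y : Free K V W} : mk E x = mk E y ↔ Cong E x y :=
  Quotient.eq (r := (Leavitt.ringCon K E).toSetoid)

noncomputable instance : SMul K (LeavittPathAlgebra K E) where
  smul k := Quotient.map (k • ·) fun _ _ h => Cong.smul k h

theorem mk_smul (k : K) (x : Free K V W) : mk E (k • x) = k • mk E x := rfl

noncomputable instance : Module K (LeavittPathAlgebra K E) :=
  Function.Surjective.module K (mk E).toAddMonoidHom mk_surjective mk_smul

instance : IsScalarTower K (LeavittPathAlgebra K E) (LeavittPathAlgebra K E) where
  smul_assoc k a b := by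
    obtain ⟨x, rfl⟩ := mk_surjective a
    obtain ⟨y, rfl⟩ := mk_surjective b
    simp only [smul_eq_mul, ← mk_smul, ← map_mul, smul_mul_assoc]

instance : SMulCommClass K (LeavittPathAlgebra K E) (LeavittPathAlgebra K E) where
  smul_comm k a b := by
    obtain ⟨x, rfl⟩ := mk_surjective a
    obtain ⟨y, rfl⟩ := mk_surjective b
    simp only [smul_eq_mul, ← mk_smul, ← map_mul, mul_smul_comm]

/-- A vertex, as an element of the Leavitt path algebra. -/
noncomputable def vertex (K : Type*) [Field K] (E : DirectedGraph V W) (v : V) :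
    LeavittPathAlgebra K E := mk E (gen (.vertex v))

/-- An edge `e`, as an element of the Leavitt path algebra. -/
noncomputable def edge (K : Type*) [Field K] (E : DirectedGraph V W) (e : W) :
    LeavittPathAlgebra K E := mk E (gen (.edge e))

/-- A ghost edge `e*`, as an element of the Leavitt path algebra. -/
noncomputable def ghost (K : Type*) [Field K] (E : DirectedGraph V W) (e : W) :
    LeavittPathAlgebra K E := mk E (gen (.ghost e))

section Star

variable [StarRing K]

noncomputable instance : Star (LeavittPathAlgebra K E) where
  star := Quotient.map freeStar fun _ _ h => Cong.freeStar h

theorem star_mk (x : Free K V W) : star (mk E x) = mk E (freeStar x) := rfl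

/-- The involution of `L_K(E)` induced by the involution of `K`: the conjugate-linear
anti-automorphism which fixes the vertices and exchanges `e` and `e*`, so that
`∑ kᵢ pᵢ qᵢ* ↦ ∑ k̄ᵢ qᵢ pᵢ*`. -/
noncomputable instance : StarRing (LeavittPathAlgebra K E) where
  star_involutive a := by
    obtain ⟨x, rfl⟩ := mk_surjective a
    rw [star_mk, star_mk, freeStar_freeStar]
  star_mul a b := by
    obtain ⟨x, rfl⟩ := mk_surjective a
    obtain ⟨y, rfl⟩ := mk_surjective b
    rw [← map_mul, star_mk, star_mk, star_mk, freeStar_mul, map_mul]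
  star_add a b := by
    obtain ⟨x, rfl⟩ := mk_surjective a
    obtain ⟨y, rfl⟩ := mk_surjective b
    rw [← map_add, star_mk, star_mk, star_mk, map_add, map_add]

instance : StarModule K (LeavittPathAlgebra K E) where
  star_smul k a := by
    obtain ⟨x, rfl⟩ := mk_surjective a
    rw [← mk_smul, star_mk, star_mk, freeStar_smul, mk_smul]

theorem star_vertex (v : V) : star (vertex K E v) = vertex K E v := by
  rw [vertex, star_mk, freeStar_gen, Gen.adj]

theorem star_edge (e : W) : star (edge K E e) = ghost K E e := by
  rw [edge, star_mk, freeStar_gen, Gen.adj, ghost]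

theorem star_ghost (e : W) : star (ghost K E e) = edge K E e := by
  rw [ghost, star_mk, freeStar_gen, Gen.adj, edge]

end Star

end LeavittPathAlgebra

/-!
A branching system of `E` on a set `Y` gives a representation of `L_K(E)` on the finitely supported
functions on `Y`, by partial bijections of the standard basis. It turns `*` into the adjoint with
respect to the form `⟨u, w⟩ = ∑ u(y) w̄(y)`. If `∑ xᵢ* xᵢ = 0`, then `∑ ⟨xᵢ u, xᵢ u⟩ = 0` for every
`u`, and hence `xᵢ u = 0`, as the involution of `K` is positive definite; so a faithful
representation suffices.

Such a representation comes from the boundary paths of `E`, that is, the infinite paths and the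
paths which end in a vertex that is not regular. It is faithful because (CK2) rewrites every element
as a combination of monomials `p q*` in which `q` has a prescribed length `N`, or has length at most
`N` and ends in a vertex that is not regular, and these monomials act by linearly independent maps.
-/

section PositiveDefinite

variable {R : Type*} [CommRing R] [StarRing R] {Y : Type*}

theorem IsPositiveDefiniteInvolution.eq_zero_of_sum_star_mul_self {S : Type*} [NonUnitalRing S]
    [StarRing S] (hS : IsPositiveDefiniteInvolution S) {ι : Type*} {s : Finset ι} {f : ι → S}
    (h : ∑ i ∈ s, star (f i) * f i = 0) {i : ι} (hi : i ∈ s) : f i = 0 := by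
  have hsum : ∑ j, star (f (s.equivFin.symm j)) * f (s.equivFin.symm j) = 0 := by
    rwa [Equiv.sum_comp s.equivFin.symm fun i : s => star (f i) * f i,
      Finset.sum_coe_sort s fun i => star (f i) * f i]
  simpa using hS _ (Finset.card_pos.2 ⟨i, hi⟩) _ hsum (s.equivFin ⟨i, hi⟩)

variable (R Y) in
/-- The hermitian form `⟨u, w⟩ = ∑ u(y) w̄(y)` for which the standard basis is orthonormal. It is
linear in the first argument, as `LinearMap.IsAdjointPair` requires. -/
noncomputable def stdForm : (Y →₀ R) →ₗ[R] (Y →₀ R) →ₗ⋆[R] R :=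
  Finsupp.linearCombination R fun y =>
    (starLinearEquiv R (A := R)).toLinearMap.comp (Finsupp.lapply (R := R) y)

theorem stdForm_apply (u w : Y →₀ R) : stdForm R Y u w = u.sum fun y c => c * star (w y) := by
  simp [stdForm, Finsupp.linearCombination_apply, Finsupp.sum, LinearMap.sum_apply]

theorem stdForm_single_left (y : Y) (c : R) (w : Y →₀ R) :
    stdForm R Y (.single y c) w = c * star (w y) := by
  rw [stdForm_apply, Finsupp.sum_single_index (zero_mul _)]

theorem stdForm_single_right (u : Y →₀ R) (y : Y) (d : R) :
    stdForm R Y u (.single y d) = u y * star d := by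
  rw [stdForm_apply, Finsupp.sum_eq_single y, Finsupp.single_eq_same]
  · intro x _ hx
    rw [Finsupp.single_eq_of_ne hx, star_zero, mul_zero]
  · intro _
    exact zero_mul _

theorem eq_zero_of_sum_stdForm_self (hR : IsPositiveDefiniteInvolution R) {ι : Type*}
    {s : Finset ι} {u : ι → Y →₀ R} (h : ∑ i ∈ s, stdForm R Y (u i) (u i) = 0) {i : ι}
    (hi : i ∈ s) : u i = 0 := by
  have hsum : ∑ iy ∈ s.sigma fun i => (u i).support, star (u iy.1 iy.2) * u iy.1 iy.2 = 0 := by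
    simpa only [Finset.sum_sigma, stdForm_apply, Finsupp.sum, mul_comm (star _)] using h
  ext y
  by_contra hy
  exact hy <| hR.eq_zero_of_sum_star_mul_self hsum (i := ⟨i, y⟩) <|
    Finset.mem_sigma.2 ⟨hi, Finsupp.mem_support_iff.2 hy⟩

theorem isPositiveDefiniteInvolution_of_isAdjointPair (hR : IsPositiveDefiniteInvolution R)
    {S F : Type*} [NonUnitalRing S] [StarRing S] [FunLike F S (Module.End R (Y →₀ R))]
    [NonUnitalRingHomClass F S (Module.End R (Y →₀ R))] {ρ : F}
    (hρ : ∀ a, LinearMap.IsAdjointPair (stdForm R Y) (stdForm R Y) (ρ a) (ρ (star a)))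
    (hinj : Function.Injective ρ) : IsPositiveDefiniteInvolution S := by
  intro n _ x hx i
  refine hinj (LinearMap.ext fun u => ?_)
  rw [map_zero, LinearMap.zero_apply]
  have hsum : ∑ i, stdForm R Y (ρ (x i) u) (ρ (x i) u) = 0 :=
    calc
      _ = ∑ i, stdForm R Y u (ρ (star (x i) * x i) u) := by
        simp only [hρ _ _ _, map_mul, Module.End.mul_apply]
      _ = stdForm R Y u (ρ (∑ i, star (x i) * x i) u) := by
        rw [map_sum, LinearMap.sum_apply, map_sum]
      _ = 0 := by rw [hx, map_zero, LinearMap.zero_apply, map_zero]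
  exact eq_zero_of_sum_stdForm_self hR hsum (Finset.mem_univ i)

end PositiveDefinite

section PartialEquiv

variable {X Y Z : Type*}

/-- The linear map of free modules induced by a partial bijection of their bases: it kills the
basis vectors outside of the domain. -/
noncomputable def lmapPEquiv (R : Type*) [CommSemiring R] (f : X ≃. Y) :
    (X →₀ R) →ₗ[R] (Y →₀ R) :=
  Finsupp.linearCombination R fun x => (f x).elim 0 (Finsupp.single · 1)

section CommSemiring

variable {R : Type*} [CommSemiring R]

open Classical in
theorem lmapPEquiv_single_apply (f : X ≃. Y) (x : X) (c : R) (y : Y) :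
    lmapPEquiv R f (.single x c) y = if y ∈ f x then c else 0 := by
  rw [lmapPEquiv, Finsupp.linearCombination_single]
  cases f x <;> simp [Finsupp.single_apply]

theorem lmapPEquiv_single_of_mem {f : X ≃. Y} {x : X} {y : Y} (h : y ∈ f x) (c : R) :
    lmapPEquiv R f (.single x c) = .single y c := by
  rw [lmapPEquiv, Finsupp.linearCombination_single, Option.mem_def.1 h]
  simp

theorem lmapPEquiv_single_of_eq_none {f : X ≃. Y} {x : X} (h : f x = none) (c : R) :
    lmapPEquiv R f (.single x c) = 0 := by
  rw [lmapPEquiv, Finsupp.linearCombination_single, h, Option.elim_none, smul_zero]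

theorem lmapPEquiv_bot : lmapPEquiv R (⊥ : X ≃. Y) = 0 :=
  Finsupp.lhom_ext fun _ c => lmapPEquiv_single_of_eq_none rfl c

theorem lmapPEquiv_trans (f : X ≃. Y) (g : Y ≃. Z) :
    lmapPEquiv R (f.trans g) = lmapPEquiv R g ∘ₗ lmapPEquiv R f := by
  refine Finsupp.lhom_ext fun x c => ?_
  rw [LinearMap.comp_apply]
  cases hx : f x with
  | none =>
    rw [lmapPEquiv_single_of_eq_none hx, map_zero]
    exact lmapPEquiv_single_of_eq_none (congrArg (Option.bind · g) hx) c
  | some y =>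
    rw [lmapPEquiv_single_of_mem hx]
    classical
    ext z
    simp only [lmapPEquiv_single_apply, PEquiv.mem_trans, hx, Option.mem_some_iff,
      exists_eq_left']

open Classical in
theorem sum_lmapPEquiv {ι : Type*} {s : Finset ι} {f : ι → X ≃. Y} {g : X ≃. Y}
    (hfg : ∀ x y, y ∈ g x ↔ ∃ i ∈ s, y ∈ f i x)
    (hf : ∀ i ∈ s, ∀ j ∈ s, ∀ x y, y ∈ f i x → y ∈ f j x → i = j) :
    ∑ i ∈ s, lmapPEquiv R (f i) = lmapPEquiv R g := by
  refine Finsupp.lhom_ext fun x c => Finsupp.ext fun y => ?_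
  simp only [LinearMap.sum_apply, Finsupp.finsetSum_apply, lmapPEquiv_single_apply]
  split_ifs with h
  · obtain ⟨i, hi, hy⟩ := (hfg x y).1 h
    rw [Finset.sum_eq_single_of_mem i hi fun j hj hji =>
      if_neg fun hj' => hji (hf j hj i hi x y hj' hy), if_pos hy]
  · exact Finset.sum_eq_zero fun i hi => if_neg fun hy => h ((hfg x y).2 ⟨i, hi, hy⟩)

variable (R) in
/-- The entry in column `x` and row `y` of an endomorphism of the free module on `X`. -/
noncomputable def matrixEntry (x y : X) : Module.End R (X →₀ R) →ₗ[R] R :=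
  Finsupp.lapply y ∘ₗ LinearMap.applyₗ (.single x 1)

open Classical in
theorem matrixEntry_lmapPEquiv (f : X ≃. X) (x y : X) :
    matrixEntry R x y (lmapPEquiv R f) = if y ∈ f x then 1 else 0 :=
  lmapPEquiv_single_apply f x 1 y

end CommSemiring

theorem isAdjointPair_lmapPEquiv {R : Type*} [CommRing R] [StarRing R] (f : X ≃. Y) :
    LinearMap.IsAdjointPair (stdForm R X) (stdForm R Y) (lmapPEquiv R f)
      (lmapPEquiv R f.symm) := by
  classical
  intro u w
  induction u using Finsupp.induction_linear with
  | zero => simp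
  | add u u' h h' => simp only [map_add, LinearMap.add_apply, h, h']
  | single x c =>
    induction w using Finsupp.induction_linear with
    | zero => simp
    | add w w' h h' => simp only [map_add, h, h']
    | single y d =>
      simp only [stdForm_single_left, stdForm_single_right, lmapPEquiv_single_apply,
        PEquiv.mem_iff_mem]
      split_ifs <;> simp

end PartialEquiv

theorem linearIndepOn_of_triangular {R M ι α : Type*} [Ring R] [AddCommGroup M] [Module R M]
    [LinearOrder α] {v : ι → M} {s : Set ι} (deg : ι → α)
    (h : ∀ i ∈ s, ∃ φ : M →ₗ[R] R, φ (v i) = 1 ∧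
      ∀ j ∈ s, deg i ≤ deg j → j ≠ i → φ (v j) = 0) :
    LinearIndepOn R v s := by
  rw [linearIndepOn_iff]
  intro l hl hsum
  by_contra hne
  obtain ⟨i, hi, hmin⟩ := l.support.exists_min_image deg (Finsupp.support_nonempty_iff.2 hne)
  have hs : ∀ j ∈ l.support, j ∈ s := fun j hj => (Finsupp.mem_supported R l).1 hl hj
  obtain ⟨φ, hφi, hφ⟩ := h i (hs i hi)
  have hli : φ (Finsupp.linearCombination R v l) = l i := by
    rw [Finsupp.linearCombination_apply, Finsupp.sum, map_sum,
      Finset.sum_eq_single_of_mem i hi fun j hj hji => ?_, map_smul, hφi, smul_eq_mul, mul_one]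
    rw [map_smul, hφ j (hs j hj) (hmin j hj) hji, smul_zero]
  rw [hsum, map_zero] at hli
  exact Finsupp.mem_support_iff.1 hi hli.symm

namespace DirectedGraph

variable {V W : Type*}

/-- A vertex is regular if it emits a finite nonzero number of edges; these are the vertices at
which the relation (CK2) is imposed. -/
def IsRegular (E : DirectedGraph V W) (v : V) : Prop :=
  {e : W | E.s e = v}.Finite ∧ {e : W | E.s e = v}.Nonempty

/-- The source of the path with list of edges `p` and range `v`; the range is needed to make sense
of the path of length `0` at `v`. -/
def pathSrc (E : DirectedGraph V W) : List W → V → V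
  | [], v => v
  | e :: _, _ => E.s e

/-- The list of edges `p` is a path in `E` with range `v`. -/
def IsPath (E : DirectedGraph V W) : List W → V → Prop
  | [], _ => True
  | e :: p, v => E.r e = E.pathSrc p v ∧ E.IsPath p v

/-- The triples `(p, v, q)` of paths `p` and `q` with common range `v` such that `q` has length at
most `N`, with equality if `v` is regular. They index the monomials `p q*` to which (CK2) cannot be
applied without `q` becoming longer than `N`. -/
def reducedTriples (E : DirectedGraph V W) (N : ℕ) : Set (List W × V × List W) :=
  {m | E.IsPath m.1 m.2.1 ∧ E.IsPath m.2.2 m.2.1 ∧ m.2.2.length ≤ N ∧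
    (E.IsRegular m.2.1 → m.2.2.length = N)}

end DirectedGraph

namespace Leavitt

variable (K : Type*) [Field K] {V W A : Type*} [NonUnitalSemiring A] [Module K A]
  [IsScalarTower K A A] [SMulCommClass K A A]

/-- The homomorphism from the free algebra with given values on the generators. -/
noncomputable def freeLift (f : Gen V W → A) : Free K V W →ₙₐ[K] A :=
  MonoidAlgebra.liftMagma K (FreeSemigroup.lift f)

theorem freeLift_gen (f : Gen V W → A) (g : Gen V W) : freeLift K f (gen g) = f g := by
  simp [freeLift, gen, MonoidAlgebra.liftMagma]

theorem Cong.map_eq {K : Type*} [Field K] [Module K A] {E : DirectedGraph V W}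
    {φ : Free K V W →ₙₐ[K] A} (hφ : ∀ x y, Rel E x y → φ x = φ y) {x y : Free K V W}
    (h : Cong E x y) : φ x = φ y := by
  induction h with
  | of h => exact hφ _ _ h
  | refl x => rfl
  | symm _ ih => exact ih.symm
  | trans _ _ ih ih' => exact ih.trans ih'
  | add _ _ ih ih' => rw [map_add, map_add, ih, ih']
  | mul _ _ ih ih' => rw [map_mul, map_mul, ih, ih']
  | smul k _ ih => rw [map_smul, map_smul, ih]

end Leavitt

namespace LeavittPathAlgebra

open Leavitt

variable {K : Type*} [Field K] {V W : Type*} {E : DirectedGraph V W}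

section Lift

variable {A : Type*} [NonUnitalSemiring A] [Module K A] [IsScalarTower K A A] [SMulCommClass K A A]

/-- The universal property of `L_K(E)`. -/
noncomputable def lift (f : Gen V W → A)
    (hf : ∀ x y, Rel E x y → freeLift K f x = freeLift K f y) :
    LeavittPathAlgebra K E →ₙₐ[K] A where
  toFun := Quotient.lift (freeLift K f) fun _ _ => Cong.map_eq hf
  map_smul' k := mk_surjective.forall.2 (map_smul (freeLift K f) k)
  map_zero' := map_zero (freeLift K f)
  map_add' := mk_surjective.forall₂.2 (map_add (freeLift K f))
  map_mul' := mk_surjective.forall₂.2 (map_mul (freeLift K f))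

theorem lift_mk_gen (f : Gen V W → A) (hf : ∀ x y, Rel E x y → freeLift K f x = freeLift K f y)
    (g : Gen V W) : lift f hf (mk E (gen g)) = f g :=
  freeLift_gen K f g

end Lift

@[elab_as_elim]
theorem induction_on {P : LeavittPathAlgebra K E → Prop} (a : LeavittPathAlgebra K E)
    (zero : P 0) (gen : ∀ g, P (mk E (gen g))) (add : ∀ a b, P a → P b → P (a + b))
    (mul : ∀ a b, P a → P b → P (a * b)) (smul : ∀ (k : K) a, P a → P (k • a)) : P a := by
  obtain ⟨x, rfl⟩ := mk_surjective a
  induction x using MonoidAlgebra.induction_linear with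
  | zero => rwa [map_zero]
  | add x y hx hy => rw [map_add]; exact add _ _ hx hy
  | single w k =>
    suffices h : P (mk E (.single w 1)) by
      rw [← mul_one k, ← smul_eq_mul, ← MonoidAlgebra.smul_single, mk_smul]
      exact smul k _ h
    induction w using FreeSemigroup.recOnMul with
    | ih1 g => exact gen g
    | ih2 g w hg hw =>
      rw [← mul_one (1 : K), ← MonoidAlgebra.single_mul_single, map_mul]
      exact mul _ _ hg hw

section Relations

theorem mk_eq_of_rel {x y : Free K V W} (h : Rel E x y) : mk E x = mk E y :=
  mk_eq_iff.2 (.of h)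

theorem vertex_mul_self (v : V) : vertex K E v * vertex K E v = vertex K E v :=
  mk_eq_of_rel (.vertex_mul_self v)

theorem vertex_mul_of_ne {v w : V} (h : v ≠ w) : vertex K E v * vertex K E w = 0 :=
  mk_eq_of_rel (.vertex_mul_of_ne v w h)

theorem source_mul_edge (e : W) : vertex K E (E.s e) * edge K E e = edge K E e :=
  mk_eq_of_rel (.source_mul_edge e)

theorem edge_mul_range (e : W) : edge K E e * vertex K E (E.r e) = edge K E e :=
  mk_eq_of_rel (.edge_mul_range e)

theorem range_mul_ghost (e : W) : vertex K E (E.r e) * ghost K E e = ghost K E e :=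
  mk_eq_of_rel (.range_mul_ghost e)

theorem ghost_mul_source (e : W) : ghost K E e * vertex K E (E.s e) = ghost K E e :=
  mk_eq_of_rel (.ghost_mul_source e)

theorem ghost_mul_edge_self (e : W) : ghost K E e * edge K E e = vertex K E (E.r e) :=
  mk_eq_of_rel (.ghost_mul_edge_self e)

theorem ghost_mul_edge_of_ne {e f : W} (h : e ≠ f) : ghost K E e * edge K E f = 0 :=
  mk_eq_of_rel (.ghost_mul_edge_of_ne e f h)

theorem vertex_eq_sum_edge_mul_ghost {v : V} (h : E.IsRegular v) :
    vertex K E v = ∑ e ∈ h.1.toFinset, edge K E e * ghost K E e :=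
  (mk_eq_of_rel (.sum_edge_mul_ghost v h.1 h.2)).trans (map_sum (mk E) _ _)

theorem ghost_mul_vertex_of_ne {v : V} {e : W} (h : E.s e ≠ v) :
    ghost K E e * vertex K E v = 0 := by
  rw [← ghost_mul_source, mul_assoc, vertex_mul_of_ne h, mul_zero]

end Relations

section Paths

variable (K E) in
/-- The product of the edges of `p`, followed by the vertex `v`. It vanishes unless `p` is a path
with range `v`. -/
noncomputable def path : List W → V → LeavittPathAlgebra K E
  | [], v => vertex K E v
  | e :: p, v => edge K E e * path p v

variable (K E) in
/-- The element `q*`, where `q` is followed by the vertex `v`. -/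
noncomputable def ghostPath : List W → V → LeavittPathAlgebra K E
  | [], v => vertex K E v
  | e :: q, v => ghostPath q v * ghost K E e

variable (K E) in
/-- The element `p q*`, where `m = (p, v, q)` and `v` is the common range of `p` and `q`. -/
noncomputable def monomial (m : List W × V × List W) : LeavittPathAlgebra K E :=
  path K E m.1 m.2.1 * ghostPath K E m.2.2 m.2.1

theorem pathSrc_mul_path (p : List W) (v : V) :
    vertex K E (E.pathSrc p v) * path K E p v = path K E p v := by
  cases p with
  | nil => exact vertex_mul_self v
  | cons e p => rw [DirectedGraph.pathSrc, path, ← mul_assoc, source_mul_edge]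

theorem vertex_mul_path_of_ne {p : List W} {u v : V} (h : u ≠ E.pathSrc p v) :
    vertex K E u * path K E p v = 0 := by
  rw [← pathSrc_mul_path, ← mul_assoc, vertex_mul_of_ne h, zero_mul]

theorem ghostPath_mul_pathSrc (q : List W) (v : V) :
    ghostPath K E q v * vertex K E (E.pathSrc q v) = ghostPath K E q v := by
  cases q with
  | nil => exact vertex_mul_self v
  | cons e q => rw [DirectedGraph.pathSrc, ghostPath, mul_assoc, ghost_mul_source]

theorem ghostPath_mul_vertex_of_ne {q : List W} {u v : V} (h : E.pathSrc q v ≠ u) :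
    ghostPath K E q v * vertex K E u = 0 := by
  rw [← ghostPath_mul_pathSrc, mul_assoc, vertex_mul_of_ne h, mul_zero]

theorem path_eq_zero {p : List W} {v : V} (h : ¬ E.IsPath p v) : path K E p v = 0 := by
  induction p with
  | nil => exact absurd trivial h
  | cons e p ih =>
    rw [path]
    by_cases hr : E.r e = E.pathSrc p v
    · rw [ih fun hp => h ⟨hr, hp⟩, mul_zero]
    · rw [← edge_mul_range, mul_assoc, vertex_mul_path_of_ne hr, mul_zero]

theorem ghostPath_eq_zero {q : List W} {v : V} (h : ¬ E.IsPath q v) :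
    ghostPath K E q v = 0 := by
  induction q with
  | nil => exact absurd trivial h
  | cons e q ih =>
    rw [ghostPath]
    by_cases hr : E.r e = E.pathSrc q v
    · rw [ih fun hq => h ⟨hr, hq⟩, zero_mul]
    · rw [← range_mul_ghost, ← mul_assoc, ghostPath_mul_vertex_of_ne (Ne.symm hr), zero_mul]

theorem path_mul_range (p : List W) (v : V) :
    path K E p v * vertex K E v = path K E p v := by
  induction p with
  | nil => exact vertex_mul_self v
  | cons e p ih => rw [path, mul_assoc, ih]

theorem range_mul_ghostPath (q : List W) (v : V) :
    vertex K E v * ghostPath K E q v = ghostPath K E q v := by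
  induction q with
  | nil => exact vertex_mul_self v
  | cons e q ih => rw [ghostPath, ← mul_assoc, ih]

theorem path_mul_edge (p : List W) (e : W) :
    path K E p (E.s e) * edge K E e = path K E (p ++ [e]) (E.r e) := by
  induction p with
  | nil => rw [path, source_mul_edge, List.nil_append, path, path, edge_mul_range]
  | cons f p ih => rw [path, mul_assoc, ih, List.cons_append, path]

theorem ghost_mul_ghostPath (e : W) (q : List W) :
    ghost K E e * ghostPath K E q (E.s e) = ghostPath K E (q ++ [e]) (E.r e) := by
  induction q with
  | nil =>
    rw [ghostPath, ghost_mul_source, List.nil_append, ghostPath, ghostPath, range_mul_ghost]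
  | cons f q ih => rw [ghostPath, ← mul_assoc, ih, List.cons_append, ghostPath]

end Paths

section Spanning

variable (K) in
/-- The span of the monomials, i.e. the space of all `∑ᵢ kᵢ pᵢ qᵢ*`; see `mem_monomialSpan`. -/
noncomputable def monomialSpan (E : DirectedGraph V W) : Submodule K (LeavittPathAlgebra K E) :=
  Submodule.span K (Set.range (monomial K E))

theorem monomial_mem_monomialSpan (m : List W × V × List W) :
    monomial K E m ∈ monomialSpan K E :=
  Submodule.subset_span ⟨m, rfl⟩

theorem vertex_mul_monomial_mem (u : V) (m : List W × V × List W) :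
    vertex K E u * monomial K E m ∈ monomialSpan K E := by
  rw [monomial, ← mul_assoc]
  by_cases h : u = E.pathSrc m.1 m.2.1
  · rw [h, pathSrc_mul_path]
    exact monomial_mem_monomialSpan m
  · rw [vertex_mul_path_of_ne h, zero_mul]
    exact zero_mem _

theorem edge_mul_monomial (e : W) (p : List W) (v : V) (q : List W) :
    edge K E e * monomial K E (p, v, q) = monomial K E (e :: p, v, q) :=
  (mul_assoc _ _ _).symm

theorem ghost_mul_monomial_mem (e : W) (m : List W × V × List W) :
    ghost K E e * monomial K E m ∈ monomialSpan K E := by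
  obtain ⟨_ | ⟨f, p⟩, v, q⟩ := m
  · rw [monomial, ← mul_assoc, path]
    by_cases h : E.s e = v
    · subst h
      rw [ghost_mul_source, ghost_mul_ghostPath, ← range_mul_ghostPath]
      exact monomial_mem_monomialSpan ([], E.r e, q ++ [e])
    · rw [ghost_mul_vertex_of_ne h, zero_mul]
      exact zero_mem _
  · rw [← edge_mul_monomial, ← mul_assoc]
    by_cases h : e = f
    · rw [h, ghost_mul_edge_self]
      exact vertex_mul_monomial_mem _ _
    · rw [ghost_mul_edge_of_ne h, zero_mul]
      exact zero_mem _

theorem mul_mem_monomialSpan (a : LeavittPathAlgebra K E) {b : LeavittPathAlgebra K E}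
    (hb : b ∈ monomialSpan K E) : a * b ∈ monomialSpan K E := by
  induction a using induction_on generalizing b with
  | zero => rw [zero_mul]; exact zero_mem _
  | gen g =>
    have hle :
        monomialSpan K E ≤ (monomialSpan K E).comap (LinearMap.mulLeft K (mk E (gen g))) := by
      refine Submodule.span_le.2 (Set.range_subset_iff.2 fun m => ?_)
      cases g with
      | vertex u => exact vertex_mul_monomial_mem u m
      | edge e =>
        change edge K E e * monomial K E (m.1, m.2.1, m.2.2) ∈ monomialSpan K E
        rw [edge_mul_monomial]
        exact monomial_mem_monomialSpan _
      | ghost e => exact ghost_mul_monomial_mem e m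
    exact hle hb
  | add a a' h h' => rw [add_mul]; exact add_mem (h hb) (h' hb)
  | mul a a' h h' => rw [mul_assoc]; exact h (h' hb)
  | smul k a h => rw [smul_mul_assoc]; exact Submodule.smul_mem _ k (h hb)

theorem mem_monomialSpan (a : LeavittPathAlgebra K E) : a ∈ monomialSpan K E := by
  have hvertex (v : V) : vertex K E v ∈ monomialSpan K E := by
    rw [← vertex_mul_self]
    exact monomial_mem_monomialSpan ([], v, [])
  induction a using induction_on with
  | zero => exact zero_mem _
  | gen g =>
    cases g with
    | vertex v => exact hvertex v
    | edge e =>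
      rw [← edge, ← edge_mul_range]
      exact mul_mem_monomialSpan _ (hvertex _)
    | ghost e =>
      rw [← ghost, ← ghost_mul_source]
      exact mul_mem_monomialSpan _ (hvertex _)
  | add a b h h' => exact add_mem h h'
  | mul a b _ h => exact mul_mem_monomialSpan a h
  | smul k a h => exact Submodule.smul_mem _ k h

theorem monomial_eq_sum {v : V} (hv : E.IsRegular v) (p q : List W) :
    monomial K E (p, v, q) =
      ∑ e ∈ hv.1.toFinset, monomial K E (p ++ [e], E.r e, q ++ [e]) := by
  rw [monomial, ← path_mul_range, vertex_eq_sum_edge_mul_ghost hv, Finset.mul_sum, Finset.sum_mul]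
  refine Finset.sum_congr rfl fun e he => ?_
  obtain rfl : E.s e = v := by simpa using he
  rw [monomial, ← path_mul_edge, ← ghost_mul_ghostPath]
  simp only [mul_assoc]

theorem monomial_mem_span_of_imp {s : Set (List W × V × List W)} {p q : List W} {v : V}
    (h : E.IsPath p v → E.IsPath q v → (p, v, q) ∈ s) :
    monomial K E (p, v, q) ∈ Submodule.span K (monomial K E '' s) := by
  by_cases hp : E.IsPath p v
  · by_cases hq : E.IsPath q v
    · exact Submodule.subset_span ⟨_, h hp hq, rfl⟩
    · rw [monomial, ghostPath_eq_zero hq, mul_zero]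
      exact zero_mem _
  · rw [monomial, path_eq_zero hp, zero_mul]
    exact zero_mem _

theorem monomial_mem_span_reducedTriples {N : ℕ} (p : List W) (v : V) {q : List W}
    (h : q.length ≤ N) :
    monomial K E (p, v, q) ∈ Submodule.span K (monomial K E '' E.reducedTriples N) := by
  induction hd : N - q.length generalizing p v q with
  | zero => exact monomial_mem_span_of_imp fun hp hq => ⟨hp, hq, h, fun _ => by grind⟩
  | succ d ih =>
    by_cases hv : E.IsRegular v
    · rw [monomial_eq_sum hv]
      exact Submodule.sum_mem _ fun e _ => ih _ _ (by grind) (by grind)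
    · exact monomial_mem_span_of_imp fun hp hq => ⟨hp, hq, h, fun hv' => absurd hv' hv⟩

theorem exists_mem_span_reducedTriples (a : LeavittPathAlgebra K E) :
    ∃ N, a ∈ Submodule.span K (monomial K E '' E.reducedTriples N) := by
  obtain ⟨c, rfl⟩ := Finsupp.mem_span_range_iff_exists_finsupp.1 (mem_monomialSpan a)
  refine ⟨c.support.sup fun m => m.2.2.length, ?_⟩
  refine Submodule.sum_mem _ fun m hm => Submodule.smul_mem _ _ ?_
  exact monomial_mem_span_reducedTriples _ _
    (Finset.le_sup (f := fun m : List W × V × List W => m.2.2.length) hm)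

end Spanning

end LeavittPathAlgebra

/-- An `E`-branching system on a set `Y`: a partition of `Y` into sets `D v`, the fibres of `src`,
together with bijections `edge e` from `D (r e)` to pairwise disjoint subsets of `D (s e)`, such
that the images of the `edge e` with `s e = v` cover `D v` if `v` is regular. It is a
representation of `E` by partial bijections, on which the path algebra acts by permuting a basis. -/
structure BranchingSystem {V W : Type*} (E : DirectedGraph V W) (Y : Type*) where
  src : Y → V
  edge : W → Y ≃. Y
  exists_mem_iff {e : W} {y : Y} : (∃ z, z ∈ edge e y) ↔ src y = E.r e
  src_of_mem {e : W} {y z : Y} : z ∈ edge e y → src z = E.s e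
  edge_eq_of_mem {e f : W} {x y z : Y} : z ∈ edge e x → z ∈ edge f y → e = f
  exists_mem_of_isRegular {z : Y} : E.IsRegular (src z) → ∃ e y, z ∈ edge e y

namespace BranchingSystem

open Leavitt LeavittPathAlgebra

variable {V W Y : Type*} {E : DirectedGraph V W} (B : BranchingSystem E Y) {e : W} {p q : List W}
  {v : V} {x y z : Y}

open Classical in
/-- The partial bijection by which a generator of the path algebra acts. -/
noncomputable def act : Gen V W → Y ≃. Y
  | .vertex v => PEquiv.ofSet {y | B.src y = v}
  | .edge e => B.edge e
  | .ghost e => (B.edge e).symm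

theorem act_adj (g : Gen V W) : B.act g.adj = (B.act g).symm := by
  cases g with
  | vertex v => classical exact (PEquiv.ofSet_symm _).symm
  | edge e => rfl
  | ghost e => rfl

theorem mem_act_vertex : y ∈ B.act (.vertex v) x ↔ y = x ∧ B.src y = v := by
  classical exact PEquiv.mem_ofSet_iff

theorem mem_act_edge : z ∈ B.act (.edge e) y ↔ z ∈ B.edge e y :=
  Iff.rfl

theorem mem_act_ghost : z ∈ B.act (.ghost e) y ↔ y ∈ B.edge e z :=
  PEquiv.mem_iff_mem _

variable {B} in
theorem src_eq_of_mem (h : z ∈ B.edge e y) : B.src y = E.r e :=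
  B.exists_mem_iff.1 ⟨z, h⟩

section Representation

variable (K : Type*) [Field K]

theorem sum_lmapPEquiv_edge_trans_ghost (h : E.IsRegular v) :
    ∑ e ∈ h.1.toFinset, lmapPEquiv K ((B.act (.ghost e)).trans (B.act (.edge e))) =
      lmapPEquiv K (B.act (.vertex v)) := by
  refine sum_lmapPEquiv (fun y z => ?_) fun e _ f _ y z he hf => ?_
  · simp only [PEquiv.mem_trans, mem_act_vertex, mem_act_edge, mem_act_ghost,
      Set.Finite.mem_toFinset, Set.mem_ofPred_eq]
    constructor
    · rintro ⟨rfl, rfl⟩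
      obtain ⟨e, x, hx⟩ := B.exists_mem_of_isRegular h
      exact ⟨e, (B.src_of_mem hx).symm, x, hx, hx⟩
    · rintro ⟨e, rfl, x, hy, hz⟩
      exact ⟨Option.mem_unique hz hy, B.src_of_mem hz⟩
  · obtain ⟨_, -, hz⟩ := (PEquiv.mem_trans _ _ _ _).1 he
    obtain ⟨_, -, hz'⟩ := (PEquiv.mem_trans _ _ _ _).1 hf
    exact B.edge_eq_of_mem hz hz'

theorem freeLift_act_eq_of_rel {a b : Free K V W} (h : Rel E a b) :
    freeLift K (fun g => lmapPEquiv K (B.act g)) a =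
      freeLift K (fun g => lmapPEquiv K (B.act g)) b := by
  cases h <;> simp only [map_mul, map_zero, map_sum, freeLift_gen, Module.End.mul_eq_comp,
    ← lmapPEquiv_trans, ← lmapPEquiv_bot]
  case sum_edge_mul_ghost v hfin hne =>
    exact (B.sum_lmapPEquiv_edge_trans_ghost K ⟨hfin, hne⟩).symm
  all_goals
    refine congrArg _ (PEquiv.ext fun y => Option.ext fun z => ?_)
    simp only [← Option.mem_def, PEquiv.mem_trans, mem_act_vertex, mem_act_edge, mem_act_ghost,
      PEquiv.bot_apply, Option.not_mem_none]
  case ghost_mul_edge_self e =>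
    grind [B.exists_mem_iff (e := e) (y := y), (B.edge e).inj (a₁ := z) (a₂ := y)]
  all_goals grind [B.src_of_mem, B.edge_eq_of_mem, src_eq_of_mem]

/-- The representation of `L_K(E)` on the free module with basis `Y`. -/
noncomputable def rep : LeavittPathAlgebra K E →ₙₐ[K] Module.End K (Y →₀ K) :=
  lift (fun g => lmapPEquiv K (B.act g)) fun _ _ => B.freeLift_act_eq_of_rel K

theorem rep_mk_gen (g : Gen V W) :
    B.rep K (LeavittPathAlgebra.mk E (gen g)) = lmapPEquiv K (B.act g) :=
  lift_mk_gen _ _ g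

theorem isAdjointPair_rep [StarRing K] (a : LeavittPathAlgebra K E) :
    LinearMap.IsAdjointPair (stdForm K Y) (stdForm K Y) (B.rep K a) (B.rep K (star a)) := by
  induction a using induction_on with
  | zero => rw [star_zero, map_zero]; exact LinearMap.isAdjointPair_zero
  | gen g =>
    rw [star_mk, freeStar_gen, rep_mk_gen, rep_mk_gen, act_adj]
    exact isAdjointPair_lmapPEquiv _
  | add a b ha hb => rw [star_add, map_add, map_add]; exact ha.add hb
  | mul a b ha hb => rw [star_mul, map_mul, map_mul]; exact ha.mul hb
  | smul k a ha =>
    intro u w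
    rw [star_smul, map_smul, map_smul]
    simp only [LinearMap.smul_apply, map_smul, map_smulₛₗ, ha u w, starRingEnd_apply, star_star]

end Representation

/-- The partial bijection by which a path with range `v` acts. -/
noncomputable def pathEquiv : List W → V → Y ≃. Y
  | [], v => B.act (.vertex v)
  | e :: p, v => (pathEquiv p v).trans (B.edge e)

theorem mem_pathEquiv_nil : y ∈ B.pathEquiv [] v x ↔ y = x ∧ B.src y = v :=
  B.mem_act_vertex

theorem mem_pathEquiv_cons :
    z ∈ B.pathEquiv (e :: p) v x ↔ ∃ y ∈ B.pathEquiv p v x, z ∈ B.edge e y :=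
  PEquiv.mem_trans _ _ _ _

theorem rep_path (K : Type*) [Field K] (p : List W) (v : V) :
    B.rep K (path K E p v) = lmapPEquiv K (B.pathEquiv p v) := by
  induction p with
  | nil => exact B.rep_mk_gen K _
  | cons e p ih =>
    rw [path, map_mul, ih, LeavittPathAlgebra.edge, rep_mk_gen, Module.End.mul_eq_comp,
      ← lmapPEquiv_trans]
    rfl

theorem rep_ghostPath (K : Type*) [Field K] (q : List W) (v : V) :
    B.rep K (ghostPath K E q v) = lmapPEquiv K (B.pathEquiv q v).symm := by
  induction q with
  | nil =>
    rw [pathEquiv, ← act_adj]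
    exact B.rep_mk_gen K _
  | cons e q ih =>
    rw [ghostPath, map_mul, ih, ghost, rep_mk_gen, Module.End.mul_eq_comp, ← lmapPEquiv_trans]
    rfl

theorem rep_monomial (K : Type*) [Field K] (p : List W) (v : V) (q : List W) :
    B.rep K (monomial K E (p, v, q)) =
      lmapPEquiv K ((B.pathEquiv q v).symm.trans (B.pathEquiv p v)) := by
  rw [monomial, map_mul, rep_path, rep_ghostPath, lmapPEquiv_trans, Module.End.mul_eq_comp]

variable {B}

theorem src_eq_of_mem_pathEquiv (h : y ∈ B.pathEquiv p v x) : B.src x = v := by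
  induction p generalizing y with
  | nil =>
    obtain ⟨rfl, hv⟩ := B.mem_pathEquiv_nil.1 h
    exact hv
  | cons e p ih =>
    obtain ⟨w, hw, -⟩ := B.mem_pathEquiv_cons.1 h
    exact ih hw

theorem src_of_mem_pathEquiv (h : y ∈ B.pathEquiv p v x) : B.src y = E.pathSrc p v := by
  cases p with
  | nil => exact (B.mem_pathEquiv_nil.1 h).2
  | cons e p =>
    obtain ⟨w, -, hy⟩ := B.mem_pathEquiv_cons.1 h
    exact B.src_of_mem hy

theorem exists_mem_pathEquiv (hp : E.IsPath p v) (hx : B.src x = v) :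
    ∃ y, y ∈ B.pathEquiv p v x := by
  induction p with
  | nil => exact ⟨x, B.mem_pathEquiv_nil.2 ⟨rfl, hx⟩⟩
  | cons e p ih =>
    obtain ⟨y, hy⟩ := ih hp.2
    obtain ⟨z, hz⟩ := B.exists_mem_iff.2 ((src_of_mem_pathEquiv hy).trans hp.1.symm)
    exact ⟨z, B.mem_pathEquiv_cons.2 ⟨y, hy, hz⟩⟩

variable (B) in
/-- A point which is not in the image of any edge; in a branching system of boundary paths these
are the paths of length zero. -/
def IsTerminal (x : Y) : Prop :=
  ∀ e y, x ∉ B.edge e y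

theorem pathEquiv_injective {p' : List W} {v' : V} {x' : Y} (h : y ∈ B.pathEquiv p v x)
    (h' : y ∈ B.pathEquiv p' v' x') (hle : p.length ≤ p'.length)
    (hx : p'.length ≤ p.length ∨ B.IsTerminal x) : p = p' ∧ x = x' := by
  induction p generalizing p' y with
  | nil =>
    obtain ⟨rfl, -⟩ := B.mem_pathEquiv_nil.1 h
    cases p' with
    | nil => exact ⟨rfl, (B.mem_pathEquiv_nil.1 h').1⟩
    | cons e p' =>
      obtain ⟨w, -, hxw⟩ := B.mem_pathEquiv_cons.1 h'
      exact absurd hxw (hx.resolve_left (by simp) e w)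
  | cons e p ih =>
    cases p' with
    | nil => simp at hle
    | cons e' p' =>
      obtain ⟨w, hw, hyw⟩ := B.mem_pathEquiv_cons.1 h
      obtain ⟨w', hw', hyw'⟩ := B.mem_pathEquiv_cons.1 h'
      obtain rfl := B.edge_eq_of_mem hyw hyw'
      obtain rfl := (B.edge e).inj hyw hyw'
      obtain ⟨rfl, rfl⟩ := ih hw hw' (by simpa using hle) (by simpa using hx)
      exact ⟨rfl, rfl⟩

section Injective

variable {deg : Y → ℤ} (hdeg : ∀ e y z, z ∈ B.edge e y → deg z = deg y + 1)

include hdeg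

theorem deg_of_mem_pathEquiv (h : y ∈ B.pathEquiv p v x) : deg y = deg x + p.length := by
  induction p generalizing y with
  | nil =>
    obtain ⟨rfl, -⟩ := B.mem_pathEquiv_nil.1 h
    simp
  | cons e p ih =>
    obtain ⟨w, hw, hy⟩ := B.mem_pathEquiv_cons.1 h
    rw [hdeg e w y hy, ih hw, List.length_cons]
    push_cast
    ring

variable (hpt : ∀ v, ∃ y, B.src y = v ∧ (¬ E.IsRegular v → B.IsTerminal y))

include hpt

theorem linearIndepOn_rep_monomial (K : Type*) [Field K] (N : ℕ) :
    LinearIndepOn K (fun m => B.rep K (monomial K E m)) (E.reducedTriples N) := by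
  refine linearIndepOn_of_triangular (M := Module.End K (Y →₀ K)) (fun m => m.2.2.length) ?_
  rintro ⟨p, v, q⟩ ⟨hp, hq, -, hN⟩
  obtain ⟨x, hx, hterm⟩ := hpt v
  obtain ⟨y, hy : y ∈ B.pathEquiv q v x⟩ := exists_mem_pathEquiv hq hx
  obtain ⟨z, hz : z ∈ B.pathEquiv p v x⟩ := exists_mem_pathEquiv hp hx
  refine ⟨matrixEntry K y z, ?_, ?_⟩
  · rw [rep_monomial, matrixEntry_lmapPEquiv]
    exact if_pos ((PEquiv.mem_trans _ _ _ _).2 ⟨x, (PEquiv.mem_iff_mem _).2 hy, hz⟩)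
  · rintro ⟨p', v', q'⟩ ⟨-, -, hN', -⟩ hle hne
    rw [rep_monomial, matrixEntry_lmapPEquiv]
    refine if_neg fun h => ?_
    obtain ⟨x', hy', hz'⟩ := (PEquiv.mem_trans _ _ _ _).1 h
    rw [PEquiv.mem_iff_mem] at hy'
    have hq' : q'.length ≤ q.length ∨ B.IsTerminal x :=
      (em (E.IsRegular v)).imp (fun hv => (hN hv).symm ▸ hN') hterm
    obtain ⟨rfl, rfl⟩ := pathEquiv_injective hy hy' hle hq'
    have hlen : p.length = p'.length := by
      have := deg_of_mem_pathEquiv hdeg hz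
      have := deg_of_mem_pathEquiv hdeg hz'
      omega
    obtain ⟨rfl, -⟩ := pathEquiv_injective hz hz' hlen.le (.inl hlen.ge)
    obtain rfl := (src_eq_of_mem_pathEquiv hz).symm.trans (src_eq_of_mem_pathEquiv hz')
    exact hne rfl

theorem rep_injective (K : Type*) [Field K] : Function.Injective (B.rep K) := by
  refine (injective_iff_map_eq_zero _).2 fun a ha => ?_
  obtain ⟨N, hN⟩ := exists_mem_span_reducedTriples a
  obtain ⟨c, hc, rfl⟩ := (Finsupp.mem_span_image_iff_linearCombination K).1 hN
  have hc₀ : c = 0 := by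
    refine (linearIndepOn_iff (M := Module.End K (Y →₀ K))).1
      (linearIndepOn_rep_monomial hdeg hpt K N) c hc ?_
    simpa only [Finsupp.linearCombination_apply, Finsupp.sum, map_sum, map_smul] using ha
  rw [hc₀, map_zero]

end Injective

end BranchingSystem

namespace DirectedGraph

variable {V W : Type*}

/-- The graph `E` with a loop added at each vertex that is not regular. Every vertex of it emits an
edge; an infinite path of `E.withLoops` that starts with an added loop at `v` serves as the path of
length `0` at `v`. -/
def withLoops (E : DirectedGraph V W) : DirectedGraph V (W ⊕ {v // ¬ E.IsRegular v}) where
  s := Sum.elim E.s Subtype.val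
  r := Sum.elim E.r Subtype.val

theorem exists_withLoops_s_eq (E : DirectedGraph V W) (v : V) :
    ∃ e, E.withLoops.s e = v ∧ (¬ E.IsRegular v → e.isRight) := by
  by_cases hv : E.IsRegular v
  · obtain ⟨e, he⟩ := hv.2
    exact ⟨.inl e, he, absurd hv⟩
  · exact ⟨.inr ⟨v, hv⟩, rfl, fun _ => rfl⟩

/-- The infinite paths of a directed graph. -/
@[ext]
structure InfinitePath (E : DirectedGraph V W) where
  edges : ℕ → W
  r_eq_s (i : ℕ) : E.r (edges i) = E.s (edges (i + 1))

namespace InfinitePath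

variable {E : DirectedGraph V W}

theorem exists_edges_zero_eq (hE : Function.Surjective E.s) (e : W) :
    ∃ ξ : E.InfinitePath, ξ.edges 0 = e := by
  choose next hnext using hE
  refine ⟨⟨fun i => (next ∘ E.r)^[i] e, fun i => ?_⟩, rfl⟩
  rw [Function.iterate_succ_apply', Function.comp_apply, hnext]

/-- The infinite path `ξ` with its first edge removed. -/
def tail (ξ : E.InfinitePath) : E.InfinitePath where
  edges i := ξ.edges (i + 1)
  r_eq_s i := ξ.r_eq_s (i + 1)

/-- The infinite path `e ξ`. -/
def cons (e : W) (ξ : E.InfinitePath) (h : E.r e = E.s (ξ.edges 0)) : E.InfinitePath where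
  edges
    | 0 => e
    | i + 1 => ξ.edges i
  r_eq_s
    | 0 => h
    | i + 1 => ξ.r_eq_s i

theorem cons_edges_zero_tail (ξ : E.InfinitePath) :
    cons (ξ.edges 0) ξ.tail (ξ.r_eq_s 0) = ξ := by
  ext (_ | i) <;> rfl

open Classical in
/-- The partial bijection `(ξ, n) ↦ (e ξ, n + 1)`. -/
noncomputable def consShift (e : W) : E.InfinitePath × ℤ ≃. E.InfinitePath × ℤ where
  toFun y := if h : E.r e = E.s (y.1.edges 0) then some (cons e y.1 h, y.2 + 1) else none
  invFun z := if z.1.edges 0 = e then some (z.1.tail, z.2 - 1) else none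
  inv := by
    rintro ⟨ξ, n⟩ ⟨η, m⟩
    simp only [Option.ite_none_right_eq_some, Option.dite_none_right_eq_some,
      Option.some_inj, Prod.mk.injEq]
    constructor
    · rintro ⟨rfl, rfl, rfl⟩
      exact ⟨η.r_eq_s 0, η.cons_edges_zero_tail, sub_add_cancel m 1⟩
    · rintro ⟨h, rfl, rfl⟩
      exact ⟨rfl, rfl, add_sub_cancel_right n 1⟩

theorem mem_consShift {e : W} {y z : E.InfinitePath × ℤ} :
    z ∈ consShift e y ↔ z.1.edges 0 = e ∧ z.1.tail = y.1 ∧ z.2 = y.2 + 1 := by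
  rw [← PEquiv.mem_iff_mem]
  refine Option.ite_none_right_eq_some.trans ?_
  rw [Option.some_inj, Prod.ext_iff, sub_eq_iff_eq_add]

end InfinitePath

end DirectedGraph

namespace BranchingSystem

open DirectedGraph

variable {V W : Type*}

/-- The branching system of boundary paths of `E`, encoded as infinite paths of `E.withLoops`; a
path that ends in a vertex which is not regular may have several encodings, which does no harm. The
integer keeps apart `p ξ` and `p' ξ` when `p` and `p'` have different length, even if these are the
same infinite path. -/
noncomputable def boundary (E : DirectedGraph V W) :
    BranchingSystem E (E.withLoops.InfinitePath × ℤ) where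
  src y := E.withLoops.s (y.1.edges 0)
  edge e := InfinitePath.consShift (.inl e)
  exists_mem_iff {e y} := by
    simp only [InfinitePath.mem_consShift]
    constructor
    · rintro ⟨z, hz, hy, -⟩
      rw [← hy]
      exact (z.1.r_eq_s 0).symm.trans (congrArg E.withLoops.r hz)
    · intro h
      exact ⟨(.cons (.inl e) y.1 h.symm, y.2 + 1), rfl, rfl, rfl⟩
  src_of_mem h := congrArg E.withLoops.s (InfinitePath.mem_consShift.1 h).1
  edge_eq_of_mem h h' := Sum.inl_injective <|
    (InfinitePath.mem_consShift.1 h).1.symm.trans (InfinitePath.mem_consShift.1 h').1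
  exists_mem_of_isRegular {z} h := by
    cases he : z.1.edges 0 with
    | inl e => exact ⟨e, (z.1.tail, z.2 - 1), InfinitePath.mem_consShift.2 ⟨he, rfl, by simp⟩⟩
    | inr v =>
      rw [he] at h
      exact absurd h v.2

theorem snd_of_mem_boundary_edge {E : DirectedGraph V W} {e : W}
    {y z : E.withLoops.InfinitePath × ℤ} (h : z ∈ (boundary E).edge e y) : z.2 = y.2 + 1 :=
  (InfinitePath.mem_consShift.1 h).2.2

theorem exists_boundary_src_eq (E : DirectedGraph V W) (v : V) :
    ∃ y, (boundary E).src y = v ∧ (¬ E.IsRegular v → (boundary E).IsTerminal y) := by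
  obtain ⟨e, rfl, he⟩ := E.exists_withLoops_s_eq v
  obtain ⟨ξ, rfl⟩ := InfinitePath.exists_edges_zero_eq
    (fun v => (E.exists_withLoops_s_eq v).imp fun _ h => h.1) e
  refine ⟨(ξ, 0), rfl, fun hv f y hy => ?_⟩
  have hf := he hv
  rw [(InfinitePath.mem_consShift.1 hy).1] at hf
  exact Bool.false_ne_true hf

end BranchingSystem

theorem proposition2p3_general {K : Type*} [Field K] [StarRing K]
    (hK : IsPositiveDefiniteInvolution K) {V : Type*} {W : Type*} (E : DirectedGraph V W) :
    IsPositiveDefiniteInvolution (LeavittPathAlgebra K E) :=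
  isPositiveDefiniteInvolution_of_isAdjointPair hK
    ((BranchingSystem.boundary E).isAdjointPair_rep K)
    (BranchingSystem.rep_injective (deg := Prod.snd)
      (fun _ _ _ => BranchingSystem.snd_of_mem_boundary_edge)
      (BranchingSystem.exists_boundary_src_eq E) K)

theorem proposition2p3 {K : Type*} [Field K] [StarRing K]
    (hK : IsPositiveDefiniteInvolution K)
    {V : Type*} {W : Type*} (E : DirectedGraph V W) :
    IsProperInvolution (LeavittPathAlgebra K E) :=
  proposition2p3_general hK E 1 one_pos
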